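/- Let $F$ be a field and let $\Gamma=(V,E,s,r)$ be a finite directed graph with vertex set $V$, edge set $E$, and source and range maps $s,r:E\to V$. A sink is a vertex $v$ with $s^{-1}(v)=\emptyset$. A path of length $n\ge 1$ is a sequence of edges $p=e_1\cdots e_n$ with $r(e_i)=s(e_{i+1})$, and $s(p)=s(e_1)$, $r(p)=r(e_n)$; vertices $v$ are the paths of length $0$, with $s(v)=r(v)=v$. Write $l(p)$ for the length of $p$. Let $L(\Gamma)$ be the Leavitt path algebra of $\Gamma$ over $F$: the associative $F$-algebra generated by $v\in V$ and $e,e^*$ ($e\in E$) subject to $vw=\delta_{v,w}v$ for $v,w\in V$; $s(e)e=er(e)=e$ and $r(e)e^*=e^*s(e)=e^*$ for $e\in E$; $e^*f=\delta_{e,f}r(e)$ for $e,f\in E$; and $v=\sum_{s(e)=v}ee^*$ for every vertex $v$ that is not a sink. (As $V$ is finite, $\sum_{v\in V}v$ is the identity of $L(\Gamma)$.) For a path $p=e_1\cdots e_n$ put $p^*=e_n^*\cdots e_1^*$, and $v^*=v$ for $v\in V$. The algebra is $\mathbb Z$-graded by $\deg v=0$, $\deg e=1$, $\deg e^*=-1$,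 with homogeneous components $L(\Gamma)_i$. Fix an arbitrary specialization, i.e. a map $\gamma:V\setminus\{\text{sinks}\}\to E$ with $s(\gamma(v))=v$ for all $v$; the edges in its image are called special. For a path $p$ let $sd(p)$ be the length of its longest terminal segment all of whose edges are special. For real $n,s,d\ge 0$ let $V_{n,s,d}\subseteq L(\Gamma)$ be the $F$-span of the products $pq^*$, where $p,q$ are paths with $l(p)+l(q)\ge n$, $sd(p)+sd(q)\le s$ and $|l(p)-l(q)|\le d$. For real $k\ge 1$ put $V_k=\sum\{V_{n,s,d}\mid n\ge k(s+d+1)\}$. The subspaces $V_k$, $k\ge 1$, form a basis of neighbourhoods of $0$ of a topology that makes $L(\Gamma)$ a topological algebra. Let $\overline{L(\Gamma)}$ be its completion, let $\overline{L(\Gamma)_i}$ be the closure of the image of $L(\Gamma)_i$ in $\overline{L(\Gamma)}$, and let $\widehat L(\Gamma)=\sum_{i\in\mathbb Z}\overline{L(\Gamma)_i}\subseteq\overline{L(\Gamma)}$ (the algebraic sum of these subspaces), a subalgebra, with the induced topology. Let $W\subseteq V$ be a hereditary set, i.e. $W\ne\emptyset$, and whenever $w\in W$ and there is a path from $w$ to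 $u$, then $u\in W$. Let $Arr(W)$ be the set of arrival paths in $W$, that is, of all paths $p=e_1\cdots e_n$ ($n\ge 0$) with $r(p)\in W$ and $s(e_i)\notin W$ for $i=1,\dots,n$; in particular, it contains every $w\in W$ as a path of length $0$. **Lemma 10.** The (possibly infinite) sum $e(W)=\sum_{p\in Arr(W)}pp^*$ converges (unconditionally) in $\widehat L(\Gamma)$, and $e(W)$ is a central idempotent of $\widehat L(\Gamma)$. -/

import Mathlib

/-- A directed graph `(V, E, s, r)`: loops and multiple edges are allowed.  Finiteness is imposed
by `[Fintype V] [Fintype E]` where it is used. -/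
structure DirectedGraph (V E : Type*) where
  /-- source of an edge -/
  s : E → V
  /-- range of an edge -/
  r : E → V

namespace DirectedGraph

variable {V E : Type*} (Γ : DirectedGraph V E)

/-- `l = [e₁, …, eₙ]` is a path starting at `v`: `s e₁ = v` and `r eᵢ = s eᵢ₊₁`. -/
def IsWalk : V → List E → Prop
  | _, [] => True
  | v, e :: l => Γ.s e = v ∧ IsWalk (Γ.r e) l

/-- The last vertex of the path `l` starting at `v`. -/
def endpoint : V → List E → V
  | v, [] => v
  | _, e :: l => endpoint (Γ.r e) l

/-- Paths of the graph.  A path of length `0` is a vertex. -/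
@[ext] structure Path where
  /-- the source of the path -/
  src : V
  /-- the edges of the path, in order -/
  edges : List E
  valid : Γ.IsWalk src edges

namespace Path

variable {Γ}

/-- The range of a path. -/
def range (p : Γ.Path) : V := Γ.endpoint p.src p.edges

/-- The length of a path. -/
def length (p : Γ.Path) : ℕ := p.edges.length

end Path

/-- A sink is a vertex that emits no edges. -/
def IsSink (v : V) : Prop := ∀ e, Γ.s e ≠ v

/-- `w` is a descendant of `v` if there is a path from `v` to `w`. -/
def IsDescendant (v w : V) : Prop := ∃ p : Γ.Path, p.src = v ∧ p.range = w

/-- A nonempty set of vertices containing all descendants of its elements. -/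
def IsHereditary (W : Set V) : Prop :=
  W.Nonempty ∧ ∀ w ∈ W, ∀ u, Γ.IsDescendant w u → u ∈ W

/-- Arrival paths in `W`: the range is the first (and only) vertex of the path lying in `W`. -/
def Arr (W : Set V) : Set Γ.Path := {p | p.range ∈ W ∧ ∀ e ∈ p.edges, Γ.s e ∉ W}

/-- A specialization picks an outgoing edge at every vertex that is not a sink. -/
structure Specialization where
  /-- the chosen edge -/
  toFun : {v : V // ¬ Γ.IsSink v} → E
  source_toFun : ∀ v, Γ.s (toFun v) = v

variable {Γ}

/-- The special edges: those in the image of the specialization. -/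
def Specialization.IsSpecial (γ : Γ.Specialization) (e : E) : Prop := ∃ v, γ.toFun v = e

open Classical in
/-- The number of edges in the longest terminal segment of `l` consisting of special edges. -/
noncomputable def Specialization.sdList (γ : Γ.Specialization) (l : List E) : ℕ :=
  (l.rtakeWhile (fun e => decide (γ.IsSpecial e))).length

/-- `sd(p)`: the length of the longest terminal special segment of the path `p`. -/
noncomputable def Specialization.sd (γ : Γ.Specialization) (p : Γ.Path) : ℕ := γ.sdList p.edges

end DirectedGraph

namespace Leavitt

open DirectedGraph

/-- The generators `v`, `e`, `e*` of the Leavitt path algebra. -/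
inductive Gen (V E : Type*)
  | vertex (v : V)
  | edge (e : E)
  | ghost (e : E)

/-- The degrees of the generators: `deg v = 0`, `deg e = 1`, `deg e* = -1`. -/
def Gen.deg {V E : Type*} : Gen V E → ℤ
  | vertex _ => 0
  | edge _ => 1
  | ghost _ => -1

section Paths

variable {V E : Type*}

lemma isWalk_append {Γ : DirectedGraph V E} {v : V} {l m : List E} :
    Γ.IsWalk v (l ++ m) ↔ Γ.IsWalk v l ∧ Γ.IsWalk (Γ.endpoint v l) m := by
  induction l generalizing v with
  | nil => simp [IsWalk, endpoint]
  | cons e l ih => simp [IsWalk, endpoint, ih, and_assoc]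

lemma sdList_append_le {Γ : DirectedGraph V E} (γ : Γ.Specialization) (l m : List E) : γ.sdList (l ++ m) ≤ γ.sdList l + γ.sdList m := by
  classical
  simp only [Specialization.sdList, List.rtakeWhile, List.length_reverse, List.reverse_append,
    List.takeWhile_append]
  split_ifs with h
  · simp [h]; omega
  · omega

lemma sdList_le_append {Γ : DirectedGraph V E} (γ : Γ.Specialization) (l m : List E) : γ.sdList m ≤ γ.sdList (l ++ m) := by
  classical
  simp only [Specialization.sdList, List.rtakeWhile, List.length_reverse, List.reverse_append,
    List.takeWhile_append]
  split_ifs with h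
  · simp [h]
  · exact le_rfl

end Paths

section Algebra

variable (F : Type*) [Field F] {V E : Type*} [Fintype V] [Fintype E]

open FreeAlgebra in
open Classical in
/-- The defining relations of the Leavitt path algebra of a finite graph.  The last one makes the
sum of all vertices, which acts as an identity on every generator by the other relations, equal to
the unit of the free unital algebra; so the quotient is the algebra presented, without a unit being
adjoined, by the other relations. -/
inductive Rel (Γ : DirectedGraph V E) :
    FreeAlgebra F (Gen V E) → FreeAlgebra F (Gen V E) → Prop
  | vertex_mul_self (v : V) : Rel Γ (ι F (.vertex v) * ι F (.vertex v)) (ι F (.vertex v))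
  | vertex_mul_vertex (v w : V) (h : v ≠ w) : Rel Γ (ι F (.vertex v) * ι F (.vertex w)) 0
  | source_mul_edge (e : E) : Rel Γ (ι F (.vertex (Γ.s e)) * ι F (.edge e)) (ι F (.edge e))
  | edge_mul_range (e : E) : Rel Γ (ι F (.edge e) * ι F (.vertex (Γ.r e))) (ι F (.edge e))
  | range_mul_ghost (e : E) : Rel Γ (ι F (.vertex (Γ.r e)) * ι F (.ghost e)) (ι F (.ghost e))
  | ghost_mul_source (e : E) : Rel Γ (ι F (.ghost e) * ι F (.vertex (Γ.s e))) (ι F (.ghost e))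
  | ghost_mul_self (e : E) : Rel Γ (ι F (.ghost e) * ι F (.edge e)) (ι F (.vertex (Γ.r e)))
  | ghost_mul_edge (e f : E) (h : e ≠ f) : Rel Γ (ι F (.ghost e) * ι F (.edge f)) 0
  | vertex_eq_sum (v : V) (h : ¬ Γ.IsSink v) :
      Rel Γ (ι F (.vertex v)) (∑ e : E with Γ.s e = v, ι F (.edge e) * ι F (.ghost e))
  | sum_vertex : Rel Γ (∑ v : V, ι F (.vertex v)) 1

/-- The Leavitt path algebra `L(Γ)`, indexed by a specialization `γ` of `Γ`.  As an algebra it does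
not depend on `γ`; its topology, defined below, does. -/
def LPA {Γ : DirectedGraph V E} (_γ : Γ.Specialization) : Type _ := RingQuot (Rel F Γ)

variable {Γ : DirectedGraph V E} (γ : Γ.Specialization)

noncomputable instance : Ring (LPA F γ) := inferInstanceAs (Ring (RingQuot (Rel F Γ)))

noncomputable instance : Algebra F (LPA F γ) :=
  inferInstanceAs (Algebra F (RingQuot (Rel F Γ)))

/-- The quotient map from the free algebra. -/
noncomputable def mk : FreeAlgebra F (Gen V E) →ₐ[F] LPA F γ := RingQuot.mkAlgHom F (Rel F Γ)

/-- The image of a generator in `L(Γ)`. -/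
noncomputable def gen (x : Gen V E) : LPA F γ := mk F γ (FreeAlgebra.ι F x)

/-- The vertex `v` as an element of `L(Γ)`. -/
noncomputable def vtx (v : V) : LPA F γ := gen F γ (.vertex v)

/-- The edge `e` as an element of `L(Γ)`. -/
noncomputable def edg (e : E) : LPA F γ := gen F γ (.edge e)

/-- The element `e*` of `L(Γ)`. -/
noncomputable def gho (e : E) : LPA F γ := gen F γ (.ghost e)

/-- `v e₁ ⋯ eₙ`. -/
noncomputable def walkElt (v : V) (l : List E) : LPA F γ := vtx F γ v * (l.map (edg F γ)).prod

/-- `eₙ* ⋯ e₁* v`. -/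
noncomputable def walkStar (v : V) (l : List E) : LPA F γ :=
  (l.reverse.map (gho F γ)).prod * vtx F γ v

/-- The path `p = e₁ ⋯ eₙ` as an element of `L(Γ)`.  The factor `s(p)` in front changes nothing if
`n ≥ 1`, and is the path itself if `n = 0`. -/
noncomputable def pathElt (p : Γ.Path) : LPA F γ := walkElt F γ p.src p.edges

/-- The element `p* = eₙ* ⋯ e₁*` of `L(Γ)`. -/
noncomputable def pathStar (p : Γ.Path) : LPA F γ := walkStar F γ p.src p.edges

/-- The homogeneous component `L(Γ)ᵢ`: spanned by the products of generators of total
degree `i`. -/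
noncomputable def homogeneous (i : ℤ) : Submodule F (LPA F γ) :=
  Submodule.span F {x | ∃ w : List (Gen V E), (w.map Gen.deg).sum = i ∧ x = (w.map (gen F γ)).prod}

/-- The subspace `V_{n,s,d}`. -/
noncomputable def Vnsd (n s d : ℝ) : Submodule F (LPA F γ) :=
  Submodule.span F {x | ∃ p q : Γ.Path, n ≤ (p.length : ℝ) + q.length ∧
    (γ.sd p : ℝ) + γ.sd q ≤ s ∧ |(p.length : ℝ) - q.length| ≤ d ∧
    x = pathElt F γ p * pathStar F γ q}

/-- The subspace `V_k = ∑ {V_{n,s,d} | n ≥ k (s + d + 1)}`, with `n`, `s`, `d` nonnegative reals. -/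
noncomputable def Vk (k : ℝ) : Submodule F (LPA F γ) :=
  ⨆ (n : ℝ) (s : ℝ) (d : ℝ) (_ : 0 ≤ n ∧ 0 ≤ s ∧ 0 ≤ d ∧ k * (s + d + 1) ≤ n), Vnsd F γ n s d

/-! ### The subspaces `V_k` define a ring topology -/

lemma mk_rel {x y : FreeAlgebra F (Gen V E)} (h : Rel F Γ x y) : mk F γ x = mk F γ y :=
  RingQuot.mkAlgHom_rel F h

lemma vtx_mul_self (v : V) : vtx F γ v * vtx F γ v = vtx F γ v := by
  simpa [vtx, gen] using mk_rel F γ (Rel.vertex_mul_self v)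

lemma vtx_mul_vtx {v w : V} (h : v ≠ w) : vtx F γ v * vtx F γ w = 0 := by
  simpa [vtx, gen] using mk_rel F γ (Rel.vertex_mul_vertex v w h)

lemma vtx_mul_edg (e : E) : vtx F γ (Γ.s e) * edg F γ e = edg F γ e := by
  simpa [vtx, edg, gen] using mk_rel F γ (Rel.source_mul_edge e)

lemma edg_mul_vtx (e : E) : edg F γ e * vtx F γ (Γ.r e) = edg F γ e := by
  simpa [vtx, edg, gen] using mk_rel F γ (Rel.edge_mul_range e)

lemma vtx_mul_gho (e : E) : vtx F γ (Γ.r e) * gho F γ e = gho F γ e := by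
  simpa [vtx, gho, gen] using mk_rel F γ (Rel.range_mul_ghost e)

lemma gho_mul_vtx (e : E) : gho F γ e * vtx F γ (Γ.s e) = gho F γ e := by
  simpa [vtx, gho, gen] using mk_rel F γ (Rel.ghost_mul_source e)

lemma gho_mul_self (e : E) : gho F γ e * edg F γ e = vtx F γ (Γ.r e) := by
  simpa [vtx, gho, edg, gen] using mk_rel F γ (Rel.ghost_mul_self e)

lemma gho_mul_edg {e f : E} (h : e ≠ f) : gho F γ e * edg F γ f = 0 := by
  simpa [vtx, gho, edg, gen] using mk_rel F γ (Rel.ghost_mul_edge e f h)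

lemma walkElt_cons {v : V} {e : E} (l : List E) (h : Γ.s e = v) :
    walkElt F γ v (e :: l) = edg F γ e * walkElt F γ (Γ.r e) l := by
  subst h
  simp only [walkElt, List.map_cons, List.prod_cons]
  rw [← mul_assoc, ← mul_assoc, vtx_mul_edg, edg_mul_vtx]

lemma walkStar_cons {v : V} {e : E} (l : List E) (h : Γ.s e = v) :
    walkStar F γ v (e :: l) = walkStar F γ (Γ.r e) l * gho F γ e := by
  subst h
  simp [walkStar, mul_assoc, vtx_mul_gho, gho_mul_vtx]

lemma vtx_mul_walkElt (v : V) (l : List E) :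
    vtx F γ v * walkElt F γ v l = walkElt F γ v l := by
  simp only [walkElt]; rw [← mul_assoc, vtx_mul_self]

lemma walkStar_mul_vtx (v : V) (l : List E) :
    walkStar F γ v l * vtx F γ v = walkStar F γ v l := by
  simp only [walkStar]; rw [mul_assoc, vtx_mul_self]

lemma walkElt_mul_vtx {v : V} {l : List E} (h : Γ.IsWalk v l) :
    walkElt F γ v l * vtx F γ (Γ.endpoint v l) = walkElt F γ v l := by
  induction l generalizing v with
  | nil => simp [walkElt, endpoint, vtx_mul_self]
  | cons e l ih => rw [walkElt_cons F γ l h.1, endpoint, mul_assoc, ih h.2]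

lemma vtx_mul_walkStar {v : V} {l : List E} (h : Γ.IsWalk v l) :
    vtx F γ (Γ.endpoint v l) * walkStar F γ v l = walkStar F γ v l := by
  induction l generalizing v with
  | nil => simp [walkStar, endpoint, vtx_mul_self]
  | cons e l ih => rw [walkStar_cons F γ l h.1, endpoint, ← mul_assoc, ih h.2]

lemma walkElt_append {v : V} {l : List E} (m : List E) (h : Γ.IsWalk v l) :
    walkElt F γ v l * walkElt F γ (Γ.endpoint v l) m = walkElt F γ v (l ++ m) := by
  induction l generalizing v with
  | nil => simpa [walkElt, endpoint] using vtx_mul_walkElt F γ v m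
  | cons e l ih =>
    rw [List.cons_append, walkElt_cons F γ _ h.1, walkElt_cons F γ _ h.1, endpoint, mul_assoc,
      ih h.2]

lemma walkStar_append {v : V} {l : List E} (m : List E) (h : Γ.IsWalk v l) :
    walkStar F γ (Γ.endpoint v l) m * walkStar F γ v l = walkStar F γ v (l ++ m) := by
  induction l generalizing v with
  | nil => simpa [walkStar, endpoint] using walkStar_mul_vtx F γ v m
  | cons e l ih =>
    rw [List.cons_append, walkStar_cons F γ _ h.1, walkStar_cons F γ _ h.1, endpoint, ← mul_assoc,
      ih h.2]

lemma walkStar_mul_walkElt {v w : V} {l m : List E} (hl : Γ.IsWalk v l) (hm : Γ.IsWalk w m) :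
    walkStar F γ v l * walkElt F γ w m = 0 ∨
    (∃ m', v = w ∧ m = l ++ m' ∧
      walkStar F γ v l * walkElt F γ w m = walkElt F γ (Γ.endpoint v l) m') ∨
    (∃ l', v = w ∧ l = m ++ l' ∧
      walkStar F γ v l * walkElt F γ w m = walkStar F γ (Γ.endpoint w m) l') := by
  induction l generalizing v w m with
  | nil =>
    by_cases h : v = w
    · subst h
      exact Or.inr (Or.inl ⟨m, rfl, rfl, by
        simpa [walkStar, endpoint] using vtx_mul_walkElt F γ v m⟩)
    · left
      simp only [walkStar, walkElt, List.reverse_nil, List.map_nil, List.prod_nil, one_mul]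
      rw [← mul_assoc, vtx_mul_vtx F γ h, zero_mul]
  | cons e l ih =>
    cases m with
    | nil =>
      by_cases h : v = w
      · subst h
        exact Or.inr (Or.inr ⟨e :: l, rfl, rfl, by
          simpa [walkElt, endpoint] using walkStar_mul_vtx F γ v (e :: l)⟩)
      · left
        simp only [walkStar, walkElt, List.map_nil, List.prod_nil, mul_one]
        rw [mul_assoc, vtx_mul_vtx F γ h, mul_zero]
    | cons f m =>
      rw [walkStar_cons F γ l hl.1, walkElt_cons F γ m hm.1]
      by_cases h : e = f
      · subst h
        have key : walkStar F γ (Γ.r e) l * gho F γ e * (edg F γ e * walkElt F γ (Γ.r e) m) =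
            walkStar F γ (Γ.r e) l * walkElt F γ (Γ.r e) m := by
          rw [mul_assoc, ← mul_assoc (gho F γ e), gho_mul_self, vtx_mul_walkElt]
        rw [key]
        have hvw : v = w := hl.1.symm.trans hm.1
        rcases ih hl.2 hm.2 with h0 | ⟨m', -, h1, h2⟩ | ⟨l', -, h1, h2⟩
        · exact Or.inl h0
        · exact Or.inr (Or.inl ⟨m', hvw, by rw [h1, List.cons_append], h2⟩)
        · exact Or.inr (Or.inr ⟨l', hvw, by rw [h1, List.cons_append], h2⟩)
      · left
        rw [mul_assoc, ← mul_assoc (gho F γ e), gho_mul_edg F γ h, zero_mul, mul_zero]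

lemma mem_Vnsd {n s d : ℝ} (p q : Γ.Path) (h1 : n ≤ (p.length : ℝ) + q.length)
    (h2 : (γ.sd p : ℝ) + γ.sd q ≤ s) (h3 : |(p.length : ℝ) - q.length| ≤ d) :
    pathElt F γ p * pathStar F γ q ∈ Vnsd F γ n s d :=
  Submodule.subset_span ⟨p, q, h1, h2, h3, rfl⟩

lemma Vnsd_mul {n₁ s₁ d₁ n₂ s₂ d₂ : ℝ} {a b : LPA F γ} (ha : a ∈ Vnsd F γ n₁ s₁ d₁)
    (hb : b ∈ Vnsd F γ n₂ s₂ d₂) :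
    a * b ∈ Vnsd F γ ((n₁ + n₂ - d₁ - d₂) / 2) (s₁ + s₂) (d₁ + d₂) := by
  refine Submodule.mul_le.1 (?_ : Vnsd F γ n₁ s₁ d₁ * Vnsd F γ n₂ s₂ d₂ ≤ _) a ha b hb
  rw [Vnsd, Vnsd, Submodule.span_mul_span, Submodule.span_le]
  rintro _ ⟨_, ⟨p₁, q₁, a1, a2, a3, rfl⟩, _, ⟨p₂, q₂, b1, b2, b3, rfl⟩, rfl⟩
  rw [abs_le] at a3 b3
  have e0 : pathElt F γ p₁ * pathStar F γ q₁ * (pathElt F γ p₂ * pathStar F γ q₂) =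
      pathElt F γ p₁ * (pathStar F γ q₁ * pathElt F γ p₂) * pathStar F γ q₂ := by
    simp only [mul_assoc]
  simp only [e0, SetLike.mem_coe]
  obtain ⟨v₁, l₁, hp₁⟩ := p₁
  obtain ⟨w₁, m₁, hq₁⟩ := q₁
  obtain ⟨v₂, l₂, hp₂⟩ := p₂
  obtain ⟨w₂, m₂, hq₂⟩ := q₂
  simp only [pathElt, pathStar, Path.length, Specialization.sd] at *
  rcases walkStar_mul_walkElt F γ hq₁ hp₂ with h0 | ⟨l', rfl, rfl, h2⟩ | ⟨m', rfl, rfl, h2⟩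
  · simp [h0]
  · rw [h2]
    by_cases he : Γ.endpoint v₁ l₁ = Γ.endpoint w₁ m₁
    · rw [← he, walkElt_append F γ _ hp₁]
      have i1 := sdList_append_le γ l₁ l'
      have i2 := sdList_le_append γ m₁ l'
      have i1' : (γ.sdList (l₁ ++ l') : ℝ) ≤ γ.sdList l₁ + γ.sdList l' := by exact_mod_cast i1
      have i2' : (γ.sdList l' : ℝ) ≤ γ.sdList (m₁ ++ l') := by exact_mod_cast i2
      have i3 : (0 : ℝ) ≤ γ.sdList m₁ := by positivity
      have i4 : (0 : ℝ) ≤ l'.length := by positivity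
      refine mem_Vnsd F γ ⟨v₁, l₁ ++ l', isWalk_append.2 ⟨hp₁, ?_⟩⟩ ⟨w₂, m₂, hq₂⟩ ?_ ?_ ?_
      · rw [he]; exact (isWalk_append.1 hp₂).2
      · simp only [Path.length, List.length_append] at *; push_cast at *; linarith
      · simp only [Specialization.sd] at *; linarith
      · rw [abs_le]
        simp only [Path.length, List.length_append] at *; push_cast at *
        constructor <;> linarith
    · rw [← walkElt_mul_vtx F γ hp₁, ← vtx_mul_walkElt F γ (Γ.endpoint w₁ m₁), mul_assoc
        (walkElt F γ v₁ l₁), ← mul_assoc (vtx F γ _) (vtx F γ _), vtx_mul_vtx F γ he]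
      simp
  · rw [h2]
    by_cases he : Γ.endpoint w₂ m₂ = Γ.endpoint w₁ l₂
    · rw [mul_assoc, ← he, walkStar_append F γ _ hq₂]
      have i1 := sdList_append_le γ m₂ m'
      have i2 := sdList_le_append γ l₂ m'
      have i1' : (γ.sdList (m₂ ++ m') : ℝ) ≤ γ.sdList m₂ + γ.sdList m' := by exact_mod_cast i1
      have i2' : (γ.sdList m' : ℝ) ≤ γ.sdList (l₂ ++ m') := by exact_mod_cast i2
      have i3 : (0 : ℝ) ≤ γ.sdList l₂ := by positivity
      have i4 : (0 : ℝ) ≤ m'.length := by positivity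
      refine mem_Vnsd F γ ⟨v₁, l₁, hp₁⟩ ⟨w₂, m₂ ++ m', isWalk_append.2 ⟨hq₂, ?_⟩⟩ ?_ ?_ ?_
      · rw [he]; exact (isWalk_append.1 hq₁).2
      · simp only [Path.length, List.length_append] at *; push_cast at *; linarith
      · simp only [Specialization.sd] at *; linarith
      · rw [abs_le]
        simp only [Path.length, List.length_append] at *; push_cast at *
        constructor <;> linarith
    · rw [← vtx_mul_walkStar F γ hq₂, ← walkStar_mul_vtx F γ (Γ.endpoint w₁ l₂), mul_assoc,
        mul_assoc, ← mul_assoc (vtx F γ _) (vtx F γ _), vtx_mul_vtx F γ (Ne.symm he)]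
      simp

lemma Vnsd_le_Vk {k n s d : ℝ} (hs : 0 ≤ s) (hd : 0 ≤ d) (hn : 0 ≤ n)
    (h : k * (s + d + 1) ≤ n) : Vnsd F γ n s d ≤ Vk F γ k :=
  le_iSup_of_le n (le_iSup_of_le s (le_iSup_of_le d (le_iSup_of_le ⟨hn, hs, hd, h⟩ le_rfl)))

lemma Vk_le {k : ℝ} {S : Submodule F (LPA F γ)}
    (h : ∀ n s d : ℝ, 0 ≤ n → 0 ≤ s → 0 ≤ d → k * (s + d + 1) ≤ n → Vnsd F γ n s d ≤ S) :
    Vk F γ k ≤ S :=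
  iSup_le fun n => iSup_le fun s => iSup_le fun d => iSup_le fun hh =>
    h n s d hh.1 hh.2.1 hh.2.2.1 hh.2.2.2

lemma Vk_anti {k k' : ℝ} (h : k ≤ k') : Vk F γ k' ≤ Vk F γ k :=
  Vk_le F γ fun _n _s _d hn hs hd hh =>
    Vnsd_le_Vk F γ hs hd hn (le_trans (by gcongr) hh)

lemma Vk_mul_Vk {k : ℝ} (hk : 1 ≤ k) :
    Vk F γ (2 * k + 1) * Vk F γ (2 * k + 1) ≤ Vk F γ k := by
  rw [Submodule.mul_le]
  intro a ha b hb
  have hL : Vk F γ (2 * k + 1) ≤ (Vk F γ k).comap (LinearMap.mulRight F b) := by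
    refine Vk_le F γ fun n₁ s₁ d₁ hn₁ hs₁ hd₁ h₁ => ?_
    intro a ha
    have hR : Vk F γ (2 * k + 1) ≤ (Vk F γ k).comap (LinearMap.mulLeft F a) := by
      refine Vk_le F γ fun n₂ s₂ d₂ hn₂ hs₂ hd₂ h₂ => ?_
      intro b hb
      have hle : k * (s₁ + s₂ + (d₁ + d₂) + 1) ≤ (n₁ + n₂ - d₁ - d₂) / 2 := by nlinarith
      refine Vnsd_le_Vk F γ (by positivity) (by positivity) ?_ hle (Vnsd_mul F γ ha hb)
      exact le_trans (by positivity) hle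
    exact hR hb
  exact hL ha

lemma mul_Vk_aux (p q : Γ.Path) {k : ℝ} (hk : 1 ≤ k) : ∃ k' : ℝ, 1 ≤ k' ∧ ∀ x ∈ Vk F γ k',
    pathElt F γ p * pathStar F γ q * x ∈ Vk F γ k ∧
    x * (pathElt F γ p * pathStar F γ q) ∈ Vk F γ k := by
  set s₀ : ℝ := (γ.sd p : ℝ) + γ.sd q with hs₀
  set d₀ : ℝ := |(p.length : ℝ) - q.length| with hd₀
  have hs : 0 ≤ s₀ := by positivity
  have hd : 0 ≤ d₀ := abs_nonneg _
  have hm : pathElt F γ p * pathStar F γ q ∈ Vnsd F γ 0 s₀ d₀ :=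
    mem_Vnsd F γ p q (by positivity) le_rfl le_rfl
  have hc : 0 ≤ k * (s₀ + d₀ + 1) := by positivity
  refine ⟨2 * k + 1 + 2 * (k * (s₀ + d₀ + 1)) + d₀, by linarith, fun x hx => ?_⟩
  have key : ∀ n s d : ℝ, 0 ≤ s → 0 ≤ d →
      (2 * k + 1 + 2 * (k * (s₀ + d₀ + 1)) + d₀) * (s + d + 1) ≤ n →
      k * (s₀ + s + (d₀ + d) + 1) ≤ (n - d₀ - d) / 2 := by
    intro n s d h1 h2 h3
    have : 0 ≤ (2 * (k * (s₀ + d₀ + 1)) + d₀) * (s + d) := by positivity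
    nlinarith
  constructor
  · have hR : Vk F γ (2 * k + 1 + 2 * (k * (s₀ + d₀ + 1)) + d₀) ≤
        (Vk F γ k).comap (LinearMap.mulLeft F (pathElt F γ p * pathStar F γ q)) := by
      refine Vk_le F γ fun n s d hn1 hs1 hd1 h1 => ?_
      intro b hb
      have hle := key n s d hs1 hd1 h1
      have h2 : k * (s₀ + s + (d₀ + d) + 1) ≤ (0 + n - d₀ - d) / 2 := by rwa [zero_add]
      exact Vnsd_le_Vk F γ (by positivity) (by positivity) (le_trans (by positivity) h2) h2
        (Vnsd_mul F γ hm hb)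
    exact hR hx
  · have hR : Vk F γ (2 * k + 1 + 2 * (k * (s₀ + d₀ + 1)) + d₀) ≤
        (Vk F γ k).comap (LinearMap.mulRight F (pathElt F γ p * pathStar F γ q)) := by
      refine Vk_le F γ fun n s d hn1 hs1 hd1 h1 => ?_
      intro b hb
      have hle := key n s d hs1 hd1 h1
      have h2 : k * (s + s₀ + (d + d₀) + 1) ≤ (n + 0 - d - d₀) / 2 := by linarith
      exact Vnsd_le_Vk F γ (by positivity) (by positivity) (le_trans (by positivity) h2) h2
        (Vnsd_mul F γ hb hm)
    exact hR hx

lemma mul_Vk (a : LPA F γ) : ∀ k : ℝ, 1 ≤ k → ∃ k' : ℝ, 1 ≤ k' ∧ ∀ x ∈ Vk F γ k',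
    a * x ∈ Vk F γ k ∧ x * a ∈ Vk F γ k := by
  obtain ⟨a, rfl⟩ : ∃ b, mk F γ b = a := RingQuot.mkAlgHom_surjective F (Rel F Γ) a
  induction a using FreeAlgebra.induction with
  | grade0 c =>
    intro k hk
    refine ⟨k, hk, fun x hx => ?_⟩
    rw [AlgHom.commutes, ← Algebra.commutes, ← Algebra.smul_def]
    exact ⟨Submodule.smul_mem _ _ hx, Submodule.smul_mem _ _ hx⟩
  | grade1 g =>
    intro k hk
    cases g with
    | vertex v =>
      have h : vtx F γ v =
          pathElt F γ ⟨v, [], trivial⟩ * pathStar F γ ⟨v, [], trivial⟩ := by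
        simpa [pathElt, pathStar, walkElt, walkStar] using (vtx_mul_self F γ v).symm
      change ∃ k' : ℝ, 1 ≤ k' ∧ ∀ x ∈ Vk F γ k', vtx F γ v * x ∈ Vk F γ k ∧ x * vtx F γ v ∈ Vk F γ k
      rw [h]; exact mul_Vk_aux F γ _ _ hk
    | edge e =>
      have h : edg F γ e =
          pathElt F γ ⟨Γ.s e, [e], rfl, trivial⟩ * pathStar F γ ⟨Γ.r e, [], trivial⟩ := by
        simpa [pathElt, pathStar, walkElt, walkStar, vtx_mul_edg] using (edg_mul_vtx F γ e).symm
      change ∃ k' : ℝ, 1 ≤ k' ∧ ∀ x ∈ Vk F γ k', edg F γ e * x ∈ Vk F γ k ∧ x * edg F γ e ∈ Vk F γ k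
      rw [h]; exact mul_Vk_aux F γ _ _ hk
    | ghost e =>
      have h : gho F γ e =
          pathElt F γ ⟨Γ.r e, [], trivial⟩ * pathStar F γ ⟨Γ.s e, [e], rfl, trivial⟩ := by
        simpa [pathElt, pathStar, walkElt, walkStar, gho_mul_vtx] using (vtx_mul_gho F γ e).symm
      change ∃ k' : ℝ, 1 ≤ k' ∧ ∀ x ∈ Vk F γ k', gho F γ e * x ∈ Vk F γ k ∧ x * gho F γ e ∈ Vk F γ k
      rw [h]; exact mul_Vk_aux F γ _ _ hk
  | mul a b iha ihb =>
    intro k hk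
    obtain ⟨k₁, h₁, ha⟩ := iha k hk
    obtain ⟨k₂, h₂, hb⟩ := ihb k hk
    obtain ⟨k₃, h₃, ha'⟩ := iha k₂ h₂
    obtain ⟨k₄, h₄, hb'⟩ := ihb k₁ h₁
    refine ⟨max k₃ k₄, le_max_of_le_left h₃, fun x hx => ?_⟩
    have x3 := Vk_anti F γ (le_max_left k₃ k₄) hx
    have x4 := Vk_anti F γ (le_max_right k₃ k₄) hx
    rw [map_mul, mul_assoc, ← mul_assoc x]
    exact ⟨(ha _ (hb' x x4).1).1, (hb _ (ha' x x3).2).2⟩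
  | add a b iha ihb =>
    intro k hk
    obtain ⟨k₁, h₁, ha⟩ := iha k hk
    obtain ⟨k₂, h₂, hb⟩ := ihb k hk
    refine ⟨max k₁ k₂, le_max_of_le_left h₁, fun x hx => ?_⟩
    have x1 := ha x (Vk_anti F γ (le_max_left k₁ k₂) hx)
    have x2 := hb x (Vk_anti F γ (le_max_right k₁ k₂) hx)
    rw [map_add, add_mul, mul_add]
    exact ⟨add_mem x1.1 x2.1, add_mem x1.2 x2.2⟩

/-- The subspaces `V_k`, `k ≥ 1`, as additive subgroups. -/
noncomputable def basis (k : Set.Ici (1 : ℝ)) : AddSubgroup (LPA F γ) := (Vk F γ k).toAddSubgroup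

lemma isBasis : RingSubgroupsBasis (basis F γ) where
  inter i j := ⟨i ⊔ j, le_inf (Vk_anti F γ (le_sup_left : i ≤ i ⊔ j))
    (Vk_anti F γ (le_sup_right : j ≤ i ⊔ j))⟩
  mul i := by
    have hi : (1 : ℝ) ≤ i := i.2
    refine ⟨⟨2 * (i : ℝ) + 1, by simp only [Set.mem_Ici]; linarith⟩, ?_⟩
    rintro _ ⟨a, ha, b, hb, rfl⟩
    exact Submodule.mul_le.1 (Vk_mul_Vk F γ hi) a ha b hb
  leftMul x i := by
    obtain ⟨k', hk', h⟩ := mul_Vk F γ x i i.2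
    exact ⟨⟨k', hk'⟩, fun y hy => (h y hy).1⟩
  rightMul x i := by
    obtain ⟨k', hk', h⟩ := mul_Vk F γ x i i.2
    exact ⟨⟨k', hk'⟩, fun y hy => (h y hy).2⟩

/-- The topology on `L(Γ)` in which the `V_k`, `k ≥ 1`, form a basis of neighbourhoods of `0`. -/
noncomputable instance : TopologicalSpace (LPA F γ) := (isBasis F γ).topology

instance : IsTopologicalRing (LPA F γ) :=
  (isBasis F γ).toRingFilterBasis.isTopologicalRing

noncomputable instance : UniformSpace (LPA F γ) :=
  IsTopologicalAddGroup.rightUniformSpace (LPA F γ)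

instance : IsUniformAddGroup (LPA F γ) := isUniformAddGroup_of_addCommGroup

instance : ContinuousConstSMul F (LPA F γ) where
  continuous_const_smul c := by
    simp only [Algebra.smul_def]
    exact continuous_const.mul continuous_id

instance : UniformContinuousConstSMul F (LPA F γ) :=
  uniformContinuousConstSMul_of_continuousConstSMul _ _

/-! ### The graded completion -/

/-- The completion of the topological algebra `L(Γ)`. -/
abbrev Compl : Type _ := UniformSpace.Completion (LPA F γ)

/-- The canonical homomorphism from `L(Γ)` to its completion. -/
noncomputable def toCompl : LPA F γ →ₐ[F] Compl F γ :=
  { (UniformSpace.Completion.coeRingHom : LPA F γ →+* Compl F γ) with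
    commutes' := fun _ => rfl }

/-- The completion of the homogeneous component of degree `i`: its closure in the completion
of `L(Γ)`. -/
noncomputable def complHomogeneous (i : ℤ) : Submodule F (Compl F γ) :=
  ((homogeneous F γ i).map (toCompl F γ).toLinearMap).topologicalClosure

/-- The sum, inside the completion of `L(Γ)`, of the completed homogeneous components. -/
noncomputable def gradedSubmodule : Submodule F (Compl F γ) := ⨆ i : ℤ, complHomogeneous F γ i

lemma one_mem_homogeneous : (1 : LPA F γ) ∈ homogeneous F γ 0 :=
  Submodule.subset_span ⟨[], by simp, by simp⟩

lemma homogeneous_mul {i j : ℤ} {a b : LPA F γ} (ha : a ∈ homogeneous F γ i)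
    (hb : b ∈ homogeneous F γ j) : a * b ∈ homogeneous F γ (i + j) := by
  refine Submodule.mul_le.1 (?_ : homogeneous F γ i * homogeneous F γ j ≤ _) a ha b hb
  rw [homogeneous, homogeneous, Submodule.span_mul_span, Submodule.span_le]
  rintro _ ⟨_, ⟨w, hw, rfl⟩, _, ⟨z, hz, rfl⟩, rfl⟩
  exact Submodule.subset_span ⟨w ++ z, by simp [hw, hz], by simp⟩

lemma complHomogeneous_mul {i j : ℤ} {a b : Compl F γ} (ha : a ∈ complHomogeneous F γ i)
    (hb : b ∈ complHomogeneous F γ j) : a * b ∈ complHomogeneous F γ (i + j) := by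
  refine map_mem_closure₂ (continuous_mul : Continuous fun x : Compl F γ × Compl F γ => x.1 * x.2)
    ha hb ?_
  rintro _ ⟨x, hx, rfl⟩ _ ⟨y, hy, rfl⟩
  exact ⟨x * y, homogeneous_mul F γ hx hy, map_mul (toCompl F γ) x y⟩

lemma complHomogeneous_le (i : ℤ) : complHomogeneous F γ i ≤ gradedSubmodule F γ :=
  le_iSup (complHomogeneous F γ) i

lemma toCompl_mem {i : ℤ} {a : LPA F γ} (ha : a ∈ homogeneous F γ i) :
    toCompl F γ a ∈ complHomogeneous F γ i :=
  Submodule.le_topologicalClosure _ ⟨a, ha, rfl⟩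

lemma one_mem_graded : (1 : Compl F γ) ∈ gradedSubmodule F γ := by
  have h := toCompl_mem F γ (one_mem_homogeneous F γ)
  rw [map_one] at h
  exact complHomogeneous_le F γ 0 h

lemma graded_mul (a b : Compl F γ) (ha : a ∈ gradedSubmodule F γ)
    (hb : b ∈ gradedSubmodule F γ) : a * b ∈ gradedSubmodule F γ := by
  refine Submodule.mul_le.1 (?_ : gradedSubmodule F γ * gradedSubmodule F γ ≤ _) a ha b hb
  conv_lhs => rw [gradedSubmodule]
  simp only [Submodule.iSup_mul, Submodule.mul_iSup]
  refine iSup_le fun i => iSup_le fun j => Submodule.mul_le.2 fun x hx y hy => ?_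
  exact complHomogeneous_le F γ _ (complHomogeneous_mul F γ hx hy)

/-- The graded completion `L̂(Γ)`, with the topology induced from the completion of `L(Γ)`. -/
noncomputable def Lhat : Subalgebra F (Compl F γ) :=
  (gradedSubmodule F γ).toSubalgebra (one_mem_graded F γ) (graded_mul F γ)

lemma gen_mem_homogeneous (x : Gen V E) : gen F γ x ∈ homogeneous F γ x.deg :=
  Submodule.subset_span ⟨[x], by simp, by simp⟩

lemma toCompl_mem_Lhat (a : LPA F γ) : toCompl F γ a ∈ Lhat F γ := by
  obtain ⟨a, rfl⟩ : ∃ b, mk F γ b = a := RingQuot.mkAlgHom_surjective F (Rel F Γ) a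
  induction a using FreeAlgebra.induction with
  | grade0 c => rw [AlgHom.commutes, AlgHom.commutes]; exact Subalgebra.algebraMap_mem _ _
  | grade1 g => exact complHomogeneous_le F γ _ (toCompl_mem F γ (gen_mem_homogeneous F γ g))
  | mul a b iha ihb => rw [map_mul, map_mul]; exact mul_mem iha ihb
  | add a b iha ihb => rw [map_add, map_add]; exact add_mem iha ihb

/-- The canonical homomorphism from `L(Γ)` to its graded completion. -/
noncomputable def toLhat : LPA F γ →ₐ[F] Lhat F γ :=
  (toCompl F γ).codRestrict (Lhat F γ) (toCompl_mem_Lhat F γ)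

/-- The summand `p p*` in `L̂(Γ)`. -/
noncomputable def projection (p : Γ.Path) : Lhat F γ :=
  toLhat F γ (pathElt F γ p * pathStar F γ p)

/-- `e(W) = ∑ p p*`, the sum over the arrival paths `p` in `W`, taken in `L̂(Γ)`. -/
noncomputable def arrivalSum (W : Set V) : Lhat F γ := ∑' p : Γ.Arr W, projection F γ p

end Algebra

end Leavitt

/-! Every vertex is the source of at most one special edge, so a walk of special edges is determined by
its source and its length.  Hence a special terminal segment of an arrival path in `W` visits
pairwise distinct vertices before it enters `W` (otherwise it would cycle outside `W` forever), and
`sd(p) ≤ |V|` for every `p ∈ Arr(W)` (`sd_le_card`).  Since `p p*` has degree `0`, it lies in `V_k`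
as soon as `2 l(p) ≥ k (2 |V| + 1)`, which excludes only finitely many paths: the summands tend to
`0` along the cofinite filter.  The `V_k` are additive subgroups, so the completion is
nonarchimedean and this suffices for unconditional convergence there; the sum lies in the closed
degree-`0` component, hence in `L̂(Γ)` (`hasSum_arrivalSum`).

No arrival path is a proper initial segment of another one, so `p* q = 0` for distinct arrival
paths, the summands are orthogonal idempotents, and the sum is idempotent.

For centrality it is enough, by density, to commute with the generators of `L(Γ)`.  Each `p p*`
commutes with the vertices.  For an edge `f` with source outside `W`, the products `f p p*` and
`q q* f` vanish unless `s(p) = r(f)`, respectively `q = f p'` with `p'` an arrival path, and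
`p ↦ f p` matches the surviving terms; if the source of `f` is in `W`, both sums have `f` as their
only term (`commute_edg`).  Commutation with `f*` follows from that with vertices and edges through
`s(f) = ∑ g g*` (`commute_gho`).
-/

namespace DirectedGraph

variable {V E : Type*} {Γ : DirectedGraph V E}

/-! ### Special segments of arrival paths -/

lemma endpoint_append (v : V) (l m : List E) :
    Γ.endpoint v (l ++ m) = Γ.endpoint (Γ.endpoint v l) m := by
  induction l generalizing v with
  | nil => rfl
  | cons e l ih => exact ih _

lemma Specialization.IsSpecial.eq {γ : Γ.Specialization} {e f : E} (he : γ.IsSpecial e)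
    (hf : γ.IsSpecial f) (h : Γ.s e = Γ.s f) : e = f := by
  obtain ⟨v, rfl⟩ := he
  obtain ⟨w, rfl⟩ := hf
  rw [γ.source_toFun, γ.source_toFun] at h
  rw [Subtype.ext h]

/-- A walk of special edges that stops at its first entry into `W` is determined by its source. -/
lemma special_walk_unique (γ : Γ.Specialization) {W : Set V} {v : V} {l m : List E}
    (hl : Γ.IsWalk v l) (hm : Γ.IsWalk v m)
    (hls : ∀ e ∈ l, γ.IsSpecial e) (hms : ∀ e ∈ m, γ.IsSpecial e)
    (hlW : ∀ e ∈ l, Γ.s e ∉ W) (hmW : ∀ e ∈ m, Γ.s e ∉ W)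
    (hle : Γ.endpoint v l ∈ W) (hme : Γ.endpoint v m ∈ W) : l = m := by
  induction l generalizing v m with
  | nil =>
    cases m with
    | nil => rfl
    | cons f m =>
      have hv : v ∈ W := hle
      rw [← hm.1] at hv
      exact absurd hv (hmW f List.mem_cons_self)
  | cons e l ih =>
    cases m with
    | nil =>
      have hv : v ∈ W := hme
      rw [← hl.1] at hv
      exact absurd hv (hlW e List.mem_cons_self)
    | cons f m =>
      have hef : e = f := (hls e List.mem_cons_self).eq (hms f List.mem_cons_self)
        (hl.1.trans hm.1.symm)
      subst hef
      rw [ih hl.2 hm.2 (fun e h => hls e (List.mem_cons_of_mem _ h))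
        (fun e h => hms e (List.mem_cons_of_mem _ h))
        (fun e h => hlW e (List.mem_cons_of_mem _ h))
        (fun e h => hmW e (List.mem_cons_of_mem _ h)) hle hme]

/-- A repeated source would start two different walks to `W`, one a proper final segment of the
other, against `special_walk_unique`. -/
lemma special_walk_nodup (γ : Γ.Specialization) {W : Set V} {v : V} {l : List E}
    (hl : Γ.IsWalk v l) (hls : ∀ e ∈ l, γ.IsSpecial e) (hlW : ∀ e ∈ l, Γ.s e ∉ W)
    (hle : Γ.endpoint v l ∈ W) : (l.map Γ.s).Nodup := by
  induction l generalizing v with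
  | nil => simp
  | cons e l ih =>
    rw [List.map_cons, List.nodup_cons]
    refine ⟨fun hmem => ?_, ih hl.2 (fun e h => hls e (List.mem_cons_of_mem _ h))
      (fun e h => hlW e (List.mem_cons_of_mem _ h)) hle⟩
    obtain ⟨f, hf, hfe⟩ := List.mem_map.1 hmem
    obtain ⟨a, b, rfl⟩ := List.append_of_mem hf
    have hab := Leavitt.isWalk_append.1 hl.2
    have hva : Γ.endpoint (Γ.r e) a = v := by rw [← hab.2.1, hfe, hl.1]
    have hend : Γ.endpoint v (f :: b) ∈ W := by
      rw [← hva, ← endpoint_append]; exact hle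
    have heq := special_walk_unique γ hl (hva ▸ hab.2) hls
      (fun g hg => hls g (List.mem_cons_of_mem _ (List.mem_append_right _ hg))) hlW
      (fun g hg => hlW g (List.mem_cons_of_mem _ (List.mem_append_right _ hg))) hle hend
    have := congrArg List.length heq
    simp at this
    omega

lemma sd_le_card [Fintype V] (γ : Γ.Specialization) {W : Set V} {p : Γ.Path} (hp : p ∈ Γ.Arr W) :
    γ.sd p ≤ Fintype.card V := by
  classical
  obtain ⟨v, l, hl⟩ := p
  obtain ⟨hr, hs⟩ := hp
  change Γ.endpoint v l ∈ W at hr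
  change ∀ e ∈ l, Γ.s e ∉ W at hs
  change (l.rtakeWhile fun e => decide (γ.IsSpecial e)).length ≤ _
  have hsp : ∀ e ∈ l.rtakeWhile (fun e => decide (γ.IsSpecial e)), γ.IsSpecial e :=
    fun e he => by simpa using List.mem_rtakeWhile_imp he
  obtain ⟨a, ha⟩ : ∃ a, a ++ l.rtakeWhile (fun e => decide (γ.IsSpecial e)) = l :=
    List.rtakeWhile_suffix _ l
  generalize l.rtakeWhile (fun e => decide (γ.IsSpecial e)) = b at hsp ha ⊢
  subst ha
  rw [endpoint_append] at hr
  have hnd := special_walk_nodup γ (Leavitt.isWalk_append.1 hl).2 hsp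
    (fun e he => hs e (List.mem_append_right _ he)) hr
  simpa using hnd.length_le_card

lemma finite_length_lt [Finite V] [Finite E] (N : ℕ) : {p : Γ.Path | p.length < N}.Finite := by
  refine Set.Finite.of_finite_image (f := fun p : Γ.Path => (p.src, p.edges)) ?_ ?_
  · refine ((Set.finite_univ (α := V)).prod (List.finite_length_lt E N)).subset ?_
    rintro _ ⟨p, hp, rfl⟩
    exact ⟨Set.mem_univ _, hp⟩
  · intro p _ q _ h
    exact DirectedGraph.Path.ext (congrArg Prod.fst h) (congrArg Prod.snd h)

/-! ### Arrival paths -/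

lemma IsHereditary.range_mem {W : Set V} (hW : Γ.IsHereditary W) {f : E} (hf : Γ.s f ∈ W) :
    Γ.r f ∈ W :=
  hW.2 _ hf _ ⟨⟨Γ.s f, [f], rfl, trivial⟩, rfl, rfl⟩

/-- An arrival path that starts in `W` is a vertex. -/
lemma edges_eq_nil {W : Set V} {p : Γ.Path} (hp : p ∈ Γ.Arr W) (h : p.src ∈ W) :
    p.edges = [] := by
  obtain ⟨v, l, hl⟩ := p
  cases l with
  | nil => rfl
  | cons e l =>
    have hv : v ∈ W := h
    rw [← hl.1] at hv
    exact absurd hv (hp.2 e List.mem_cons_self)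

/-- The vertex `v` as a path. -/
def Path.nil (v : V) : Γ.Path := ⟨v, [], trivial⟩

lemma nil_mem_Arr {W : Set V} {v : V} (hv : v ∈ W) : Path.nil v ∈ Γ.Arr W :=
  ⟨hv, by simp [Path.nil]⟩

/-- The path `f p`. -/
def Path.cons (f : E) (p : Γ.Path) (h : p.src = Γ.r f) : Γ.Path :=
  ⟨Γ.s f, f :: p.edges, rfl, h ▸ p.valid⟩

lemma cons_mem_Arr {W : Set V} {f : E} {p : Γ.Path} (h : p.src = Γ.r f) (hf : Γ.s f ∉ W)
    (hp : p ∈ Γ.Arr W) : Path.cons f p h ∈ Γ.Arr W := by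
  refine ⟨?_, ?_⟩
  · have := hp.1
    rw [Path.range, h] at this
    exact this
  · intro e he
    rcases List.mem_cons.1 he with rfl | he
    · exact hf
    · exact hp.2 e he

end DirectedGraph

namespace Leavitt

open DirectedGraph

variable (F : Type*) [Field F] {V E : Type*} [Fintype V] [Fintype E]
  {Γ : DirectedGraph V E} (γ : Γ.Specialization)

/-! ### The summands in the Leavitt path algebra -/

lemma walkStar_mul_walkElt_self {v : V} {l : List E} (h : Γ.IsWalk v l) :
    walkStar F γ v l * walkElt F γ v l = vtx F γ (Γ.endpoint v l) := by
  induction l generalizing v with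
  | nil => simp [walkStar, walkElt, endpoint, vtx_mul_self]
  | cons e l ih =>
    rw [walkStar_cons F γ l h.1, walkElt_cons F γ l h.1, mul_assoc, ← mul_assoc (gho F γ e),
      gho_mul_self, vtx_mul_walkElt, ih h.2, endpoint]

lemma proj_mul_self (p : Γ.Path) :
    pathElt F γ p * pathStar F γ p * (pathElt F γ p * pathStar F γ p) =
      pathElt F γ p * pathStar F γ p := by
  rw [mul_assoc, ← mul_assoc (pathStar F γ p), pathStar, pathElt,
    walkStar_mul_walkElt_self F γ p.valid, vtx_mul_walkStar F γ p.valid]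

/-- Neither of two distinct arrival paths extends the other, as the first edge of the rest would
start in `W`. -/
lemma proj_mul_proj {W : Set V} {p q : Γ.Path} (hp : p ∈ Γ.Arr W) (hq : q ∈ Γ.Arr W)
    (h : p ≠ q) :
    pathElt F γ p * pathStar F γ p * (pathElt F γ q * pathStar F γ q) = 0 := by
  have extends_trivially : ∀ {v : V} {l m : List E}, Γ.endpoint v l ∈ W →
      Γ.IsWalk v (l ++ m) → (∀ e ∈ l ++ m, Γ.s e ∉ W) → m = [] := by
    intro v l m hv hw hs
    cases m with
    | nil => rfl
    | cons e m =>
      rw [← (isWalk_append.1 hw).2.1] at hv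
      exact absurd hv (hs e (by simp))
  rw [mul_assoc, ← mul_assoc (pathStar F γ p)]
  obtain ⟨v, l, hl⟩ := p
  obtain ⟨w, m, hm⟩ := q
  simp only [pathElt, pathStar]
  rcases walkStar_mul_walkElt F γ hl hm with h0 | ⟨m', rfl, rfl, -⟩ | ⟨l', rfl, rfl, -⟩
  · simp [h0]
  · obtain rfl := extends_trivially hp.1 hm hq.2
    simp at h
  · obtain rfl := extends_trivially hq.1 hl hp.2
    simp at h

lemma vtx_mul_pathElt {v : V} {p : Γ.Path} (h : v ≠ p.src) : vtx F γ v * pathElt F γ p = 0 := by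
  rw [pathElt, walkElt, ← mul_assoc, vtx_mul_vtx F γ h, zero_mul]

lemma pathStar_mul_vtx {v : V} {p : Γ.Path} (h : v ≠ p.src) : pathStar F γ p * vtx F γ v = 0 := by
  rw [pathStar, walkStar, mul_assoc, vtx_mul_vtx F γ h.symm, mul_zero]

lemma commute_vtx_proj (v : V) (p : Γ.Path) :
    Commute (pathElt F γ p * pathStar F γ p) (vtx F γ v) := by
  rw [commute_iff_eq, mul_assoc, ← mul_assoc (vtx F γ v)]
  by_cases h : v = p.src
  · subst h
    rw [pathElt, pathStar, vtx_mul_walkElt, walkStar_mul_vtx]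
  · rw [vtx_mul_pathElt F γ h, pathStar_mul_vtx F γ h, mul_zero, zero_mul]

lemma edg_mul_proj_of_ne {f : E} {p : Γ.Path} (h : p.src ≠ Γ.r f) :
    edg F γ f * (pathElt F γ p * pathStar F γ p) = 0 := by
  rw [← edg_mul_vtx, mul_assoc, ← mul_assoc (vtx F γ _), vtx_mul_pathElt F γ h.symm, zero_mul,
    mul_zero]

lemma proj_nil (v : V) :
    pathElt F γ (Path.nil v : Γ.Path) * pathStar F γ (Path.nil v : Γ.Path) = vtx F γ v := by
  simp [Path.nil, pathElt, pathStar, walkElt, walkStar, vtx_mul_self]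

lemma proj_cons_mul_edg (f : E) (p : Γ.Path) (h : p.src = Γ.r f) :
    pathElt F γ (Path.cons f p h) * pathStar F γ (Path.cons f p h) * edg F γ f =
      edg F γ f * (pathElt F γ p * pathStar F γ p) := by
  rw [pathElt, pathStar, Path.cons, walkElt_cons F γ _ rfl, walkStar_cons F γ _ rfl, ← h]
  simp only [mul_assoc]
  rw [gho_mul_self, ← h, walkStar_mul_vtx]
  rfl

/-- `q q* f` vanishes unless `q` is the vertex `s(f)` or starts with the edge `f`. -/
lemma proj_mul_edg_eq_zero {f : E} {q : Γ.Path} (h1 : q ≠ Path.nil (Γ.s f))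
    (h2 : ∀ (p : Γ.Path) (h : p.src = Γ.r f), q ≠ Path.cons f p h) :
    pathElt F γ q * pathStar F γ q * edg F γ f = 0 := by
  obtain ⟨v, l, hl⟩ := q
  cases l with
  | nil =>
    have hv : Γ.s f ≠ v := by
      rintro rfl
      exact h1 rfl
    rw [mul_assoc, ← vtx_mul_edg, ← mul_assoc (pathStar F γ _), pathStar_mul_vtx F γ hv, zero_mul,
      mul_zero]
  | cons e l =>
    have he : e ≠ f := by
      rintro rfl
      exact h2 ⟨Γ.r e, l, hl.2⟩ rfl (DirectedGraph.Path.ext hl.1.symm rfl)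
    rw [mul_assoc, pathStar, walkStar_cons F γ l hl.1, mul_assoc (walkStar F γ _ _),
      gho_mul_edg F γ he, mul_zero, mul_zero]

lemma vtx_eq_sum (v : V) (h : ¬ Γ.IsSink v) [DecidablePred fun e : E => Γ.s e = v] :
    vtx F γ v = ∑ e : E with Γ.s e = v, edg F γ e * gho F γ e := by
  have := mk_rel F γ (Rel.vertex_eq_sum v h)
  simp only [map_sum, map_mul] at this
  refine this.trans (Finset.sum_congr ?_ fun _ _ => rfl)
  ext
  simp

lemma pathElt_mem_homogeneous (p : Γ.Path) : pathElt F γ p ∈ homogeneous F γ p.length := by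
  refine Submodule.subset_span ⟨.vertex p.src :: p.edges.map .edge, ?_, ?_⟩
  · simp [Gen.deg, Function.comp_def, Path.length]
  · rw [List.map_cons, List.prod_cons, List.map_map]
    rfl

lemma pathStar_mem_homogeneous (p : Γ.Path) : pathStar F γ p ∈ homogeneous F γ (-p.length) := by
  refine Submodule.subset_span ⟨p.edges.reverse.map .ghost ++ [.vertex p.src], ?_, ?_⟩
  · simp [Gen.deg, Function.comp_def, Path.length]
  · rw [List.map_append, List.prod_append, List.map_map, List.map_singleton, List.prod_singleton]
    rfl

lemma proj_mem_homogeneous (p : Γ.Path) :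
    pathElt F γ p * pathStar F γ p ∈ homogeneous F γ 0 := by
  simpa using homogeneous_mul F γ (pathElt_mem_homogeneous F γ p) (pathStar_mem_homogeneous F γ p)

/-! ### Convergence -/

instance : NonarchimedeanAddGroup (LPA F γ) :=
  letI := (isBasis F γ).nonarchimedean
  inferInstance

lemma tendsto_proj (W : Set V) :
    Filter.Tendsto (fun p : Γ.Arr W => pathElt F γ p * pathStar F γ p) Filter.cofinite
      (nhds 0) := by
  rw [(isBasis F γ).hasBasis_nhds_zero.tendsto_right_iff]
  rintro ⟨k, hk⟩ -
  obtain ⟨N, hN⟩ := exists_nat_ge (k * (2 * Fintype.card V + 1))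
  have hfin := (finite_length_lt (Γ := Γ) N).preimage
    (f := (Subtype.val : Γ.Arr W → Γ.Path)) Subtype.val_injective.injOn
  filter_upwards [hfin.compl_mem_cofinite] with p hp
  have hlen : (N : ℝ) ≤ (p : Γ.Path).length := by
    exact_mod_cast (not_lt.1 hp : N ≤ (p : Γ.Path).length)
  have hsd : (γ.sd p : ℝ) ≤ Fintype.card V := by exact_mod_cast sd_le_card γ p.2
  have hk0 : (1 : ℝ) ≤ k := hk
  refine Vnsd_le_Vk F γ (n := 2 * (p : Γ.Path).length) (s := 2 * Fintype.card V) (d := 0)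
    (by positivity) le_rfl (by positivity) ?_ (mem_Vnsd F γ p p ?_ ?_ ?_)
  · have : (0 : ℝ) ≤ (p : Γ.Path).length := by positivity
    rw [add_zero]
    linarith
  · linarith
  · linarith
  · simp

lemma hasSum_arrivalSum (W : Set V) :
    HasSum (fun p : Γ.Arr W => projection F γ p) (arrivalSum F γ W) := by
  have hS : Summable fun p : Γ.Arr W => toCompl F γ (pathElt F γ p * pathStar F γ p) := by
    refine NonarchimedeanAddGroup.summable_of_tendsto_cofinite_zero ?_
    have := (UniformSpace.Completion.continuous_coe (LPA F γ)).continuousAt.tendsto.comp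
      (tendsto_proj F γ W)
    rwa [UniformSpace.Completion.coe_zero] at this
  obtain ⟨S, hS⟩ := hS
  have hmem : S ∈ complHomogeneous F γ 0 :=
    (Submodule.isClosed_topologicalClosure _).mem_of_tendsto hS
      (Filter.Eventually.of_forall fun s =>
        Submodule.sum_mem _ fun p _ => toCompl_mem F γ (proj_mem_homogeneous F γ p))
  have hmem' : S ∈ Lhat F γ := complHomogeneous_le F γ 0 hmem
  have hsum : HasSum (fun p : Γ.Arr W => projection F γ p) (⟨S, hmem'⟩ : Lhat F γ) :=
    (Topology.IsInducing.subtypeVal.hasSum_iff (g := (Lhat F γ).val) _ _).1 hS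
  exact hsum.summable.hasSum

lemma hasSum_coe_arrivalSum (W : Set V) :
    HasSum (fun p : Γ.Arr W => toCompl F γ (pathElt F γ p * pathStar F γ p))
      (arrivalSum F γ W : Compl F γ) :=
  (hasSum_arrivalSum F γ W).map (Lhat F γ).val continuous_subtype_val

/-! ### Idempotency and centrality -/

lemma arrivalSum_mul_self (W : Set V) :
    (arrivalSum F γ W : Compl F γ) * arrivalSum F γ W = arrivalSum F γ W := by
  have h := hasSum_coe_arrivalSum F γ W
  have hp : ∀ p : Γ.Arr W, toCompl F γ (pathElt F γ p * pathStar F γ p) * arrivalSum F γ W =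
      toCompl F γ (pathElt F γ p * pathStar F γ p) := by
    intro p
    refine (h.mul_left _).unique ?_
    convert hasSum_single p ?_ using 1
    · rw [← map_mul, proj_mul_self]
    · intro q hq
      rw [← map_mul, proj_mul_proj F γ p.2 q.2 (fun h => hq (Subtype.ext h).symm), map_zero]
  have h2 := h.mul_right (arrivalSum F γ W : Compl F γ)
  simp only [hp] at h2
  exact h2.unique h

lemma commute_vtx (W : Set V) (v : V) :
    Commute (arrivalSum F γ W : Compl F γ) (toCompl F γ (vtx F γ v)) := by
  have h := hasSum_coe_arrivalSum F γ W
  refine (h.mul_right _).unique ?_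
  convert h.mul_left (toCompl F γ (vtx F γ v)) using 2 with p
  rw [← map_mul, ← map_mul, (commute_vtx_proj F γ v p).eq]

lemma commute_edg {W : Set V} (hW : Γ.IsHereditary W) (f : E) :
    Commute (arrivalSum F γ W : Compl F γ) (toCompl F γ (edg F γ f)) := by
  have hR := (hasSum_coe_arrivalSum F γ W).mul_right (toCompl F γ (edg F γ f))
  have hL := (hasSum_coe_arrivalSum F γ W).mul_left (toCompl F γ (edg F γ f))
  simp only [← map_mul] at hL hR
  by_cases hf : Γ.s f ∈ W
  · have hrf := hW.range_mem hf
    have eR : HasSum (fun p : Γ.Arr W =>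
        toCompl F γ (pathElt F γ p * pathStar F γ p * edg F γ f)) (toCompl F γ (edg F γ f)) := by
      convert hasSum_single (⟨Path.nil (Γ.s f), nil_mem_Arr hf⟩ : Γ.Arr W) ?_ using 1
      · simp only [proj_nil, vtx_mul_edg]
      · intro q hq
        rw [proj_mul_edg_eq_zero F γ (fun h => hq (Subtype.ext h)), map_zero]
        intro p h hqp
        refine q.2.2 f ?_ hf
        rw [hqp]
        exact List.mem_cons_self
    have eL : HasSum (fun p : Γ.Arr W =>
        toCompl F γ (edg F γ f * (pathElt F γ p * pathStar F γ p))) (toCompl F γ (edg F γ f)) := by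
      convert hasSum_single (⟨Path.nil (Γ.r f), nil_mem_Arr hrf⟩ : Γ.Arr W) ?_ using 1
      · simp only [proj_nil, edg_mul_vtx]
      · intro q hq
        rw [edg_mul_proj_of_ne, map_zero]
        intro h
        exact hq (Subtype.ext (DirectedGraph.Path.ext h (edges_eq_nil q.2 (h ▸ hrf))))
    exact (hR.unique eR).trans (eL.unique hL)
  · -- Both sums reduce to sums over the arrival paths that start at `r(f)`.
    let A := {p : Γ.Arr W // (p : Γ.Path).src = Γ.r f}
    let i : A → Γ.Arr W := Subtype.val
    let j : A → Γ.Arr W := fun p => ⟨Path.cons f p.1 p.2, cons_mem_Arr p.2 hf p.1.2⟩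
    have hj : Function.Injective j := by
      intro p q h
      have h' : f :: (p.1 : Γ.Path).edges = f :: (q.1 : Γ.Path).edges :=
        congrArg (fun x : Γ.Arr W => (x : Γ.Path).edges) h
      exact Subtype.ext (Subtype.ext (DirectedGraph.Path.ext (p.2.trans q.2.symm)
        (List.cons.inj h').2))
    have hR' := (hj.hasSum_iff (fun q hq => ?_)).2 hR
    · have hL' := (Subtype.val_injective (p := fun p : Γ.Arr W =>
        (p : Γ.Path).src = Γ.r f)).hasSum_iff (fun q hq => ?_) |>.2 hL
      · refine hR'.unique ?_
        convert hL' using 1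
        funext p
        exact congrArg (toCompl F γ) (proj_cons_mul_edg F γ f p.1 p.2)
      · rw [edg_mul_proj_of_ne, map_zero]
        exact fun h => hq ⟨⟨q, h⟩, rfl⟩
    · rw [proj_mul_edg_eq_zero, map_zero]
      · intro h
        apply hf
        have := q.2.1
        rw [h] at this
        exact this
      · intro p h hqp
        have hpA : p ∈ Γ.Arr W := by
          refine ⟨?_, fun e he => q.2.2 e ?_⟩
          · have := q.2.1
            rw [hqp] at this
            rw [Path.range, h]
            exact this
          · rw [hqp]
            exact List.mem_cons_of_mem _ he
        exact hq ⟨⟨⟨p, hpA⟩, h⟩, Subtype.ext hqp.symm⟩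

/-- With `c = e(W)`: `f* c = f* c s(f) = ∑ f* c g g* = ∑ f* g c g* = r(f) c f* = c f*`. -/
lemma commute_gho {W : Set V} (hW : Γ.IsHereditary W) (f : E) :
    Commute (arrivalSum F γ W : Compl F γ) (toCompl F γ (gho F γ f)) := by
  classical
  have hv := (commute_vtx F γ W (Γ.r f)).eq
  have he := fun g => (commute_edg F γ hW g).eq
  have hs := (commute_vtx F γ W (Γ.s f)).eq
  set c : Compl F γ := (arrivalSum F γ W : Compl F γ)
  have hsink : ¬ Γ.IsSink (Γ.s f) := fun h => h f rfl
  symm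
  calc toCompl F γ (gho F γ f) * c
      = toCompl F γ (gho F γ f) * (c * toCompl F γ (vtx F γ (Γ.s f))) := by
        rw [hs, ← mul_assoc, ← map_mul, gho_mul_vtx]
    _ = ∑ g : E with Γ.s g = Γ.s f, toCompl F γ (gho F γ f * edg F γ g) *
          (c * toCompl F γ (gho F γ g)) := by
        rw [vtx_eq_sum F γ _ hsink, map_sum, Finset.mul_sum, Finset.mul_sum]
        refine Finset.sum_congr rfl fun g _ => ?_
        rw [map_mul, map_mul, ← mul_assoc c, he]
        simp only [mul_assoc]
    _ = toCompl F γ (vtx F γ (Γ.r f)) * (c * toCompl F γ (gho F γ f)) := by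
        rw [Finset.sum_eq_single f, gho_mul_self]
        · intro g _ hg
          rw [gho_mul_edg F γ hg.symm, map_zero, zero_mul]
        · simp
    _ = c * toCompl F γ (gho F γ f) := by
        rw [← mul_assoc, ← hv, mul_assoc, ← map_mul, vtx_mul_gho]

lemma commute_toCompl {W : Set V} (hW : Γ.IsHereditary W) (a : LPA F γ) :
    Commute (arrivalSum F γ W : Compl F γ) (toCompl F γ a) := by
  obtain ⟨a, rfl⟩ : ∃ b, mk F γ b = a := RingQuot.mkAlgHom_surjective F (Rel F Γ) a
  induction a using FreeAlgebra.induction with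
  | grade0 c =>
    rw [AlgHom.commutes, AlgHom.commutes]
    exact (Algebra.commutes c _).symm
  | grade1 g =>
    cases g with
    | vertex v => exact commute_vtx F γ W v
    | edge e => exact commute_edg F γ hW e
    | ghost e => exact commute_gho F γ hW e
  | mul a b iha ihb => rw [map_mul, map_mul]; exact iha.mul_right ihb
  | add a b iha ihb => rw [map_add, map_add]; exact iha.add_right ihb

lemma commute_arrivalSum {W : Set V} (hW : Γ.IsHereditary W) (x : Compl F γ) :
    Commute (arrivalSum F γ W : Compl F γ) x := by
  induction x using UniformSpace.Completion.induction_on with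
  | hp => exact isClosed_eq (continuous_const.mul continuous_id) (continuous_id.mul continuous_const)
  | ih a => exact commute_toCompl F γ hW a

end Leavitt

theorem lemma10 (F : Type*) [Field F] {V E : Type*} [Fintype V] [Fintype E]
    (Γ : DirectedGraph V E) (γ : Γ.Specialization) (W : Set V) (hW : Γ.IsHereditary W) :
    HasSum (fun p : Γ.Arr W => Leavitt.projection F γ p) (Leavitt.arrivalSum F γ W) ∧
    IsIdempotentElem (Leavitt.arrivalSum F γ W) ∧
    ∀ x : Leavitt.Lhat F γ, Commute (Leavitt.arrivalSum F γ W) x :=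
  ⟨Leavitt.hasSum_arrivalSum F γ W, Subtype.ext (Leavitt.arrivalSum_mul_self F γ W),
    fun x => Subtype.ext (Leavitt.commute_arrivalSum F γ hW x)⟩
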